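/- Consider \(\mathbb Z\) with generating set \(\{1,-1\}\). The Schreier graph of a \(\mathbb Z\)-set \(V\) has vertex set \(V\) and an edge labeled \(s\) from \(v\) to \(s\cdot v\) for every \(v\in V\), \(s\in\{1,-1\}\). For a set \(Q\), a map \(\varphi:V\to Q\) and \(r\ge 1\), let \(\mathrm{Conf}_r(\varphi)\) be the set of isomorphism classes of the rooted, edge-labeled, \(Q\)-vertex-labeled balls of radius \(r\) (induced subgraphs) that occur in \((V,\varphi)\), and let \(U^{r,Q}\) be the set of all classes that occur in some \(Q\)-labeled Schreier graph \(\mathbb Z/H\), \(H\le\mathbb Z\). A sequence \((S_k)\) of Schreier graphs of countable \(\mathbb Z\)-sets is qualitatively convergent if for every finite \(Q\), \(r\ge1\) and \(\mathcal A\subseteq U^{r,Q}\), either for all large \(k\) there is \(\varphi_k:V(S_k)\to Q\) with \(\mathrm{Conf}_r(\varphi_k)=\mathcal A\), or for all large \(k\) there is none. A continuous action \(\alpha\) of \(\mathbb Z\) on a compact totally disconnected metric space \(X\) is stable if, whenever \(\alpha(m)\) fixes \(x\), it fixes a neighbourhood of \(x\) pointwise. A stable action \(\alpha\) is a qualitative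 limit of a qualitatively convergent sequence \((S_k)\) if for every finite \(Q\), \(r\ge 1\) and \(\mathcal A\subseteq U^{r,Q}\): there is a continuous \(\psi:X\to Q\) with \(\mathrm{Conf}_r(\psi)=\mathcal A\) (with respect to \(\alpha\)) if and only if for all large \(k\) there is \(\varphi_k:V(S_k)\to Q\) with \(\mathrm{Conf}_r(\varphi_k)=\mathcal A\). The periodic spectrum \(PS(\alpha)\) is the set of integers \(n\ge 1\) for which there is a clopen \(U\subseteq X\) such that \(U,\alpha(1)U,\dots,\alpha(n-1)U\) partition \(X\). **Theorem.** Let \(W\) be a set of positive integers containing all positive divisors of each of its elements, and let \(n_1<n_2<\cdots\) be positive integers such that the sequence of cyclic Schreier graphs \(C_{n_k}\) (the Schreier graphs of \(\mathbb Z/n_k\mathbb Z\)) is qualitatively convergent and \(W\) is the arithmetic spectrum of \((n_k)\), i.e. the set of all \(m\ge1\) that divide all but finitely many \(n_k\). Then there exists a free minimal continuous action of \(\mathbb Z\) on the Cantor set with periodic spectrum \(W\), and every such action (in particular Shimomura's action \(\alpha_W\)) is a qualitative limit of \((C_{n_k})\). -/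

import Mathlib

open Topology

namespace QualLimit

/-- The symmetric generating set `{1, -1}` of `ℤ`; its elements are the edge labels. -/
abbrev Gen : Type := {s : ℤ // s = 1 ∨ s = -1}

/-- The Cantor set. -/
abbrev Cantor : Type := ℕ → Bool

/-! ### Rooted labeled balls and configurations -/

/-- A rooted directed graph with edges labeled by the generators and vertices labeled by `Q`. -/
structure RootedLabeled (Q : Type) where
  Vert : Type
  root : Vert
  edge : Gen → Vert → Vert → Prop
  label : Vert → Q

/-- Isomorphism preserving the root, the labeled edges and the vertex labels. -/
def RootedLabeled.Iso {Q : Type} (A B : RootedLabeled Q) : Prop :=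
  ∃ e : A.Vert ≃ B.Vert, e A.root = B.root ∧
    (∀ s a b, A.edge s a b ↔ B.edge s (e a) (e b)) ∧
    ∀ a, B.label (e a) = A.label a

instance RootedLabeled.setoid (Q : Type) : Setoid (RootedLabeled Q) where
  r := RootedLabeled.Iso
  iseqv :=
    { refl := fun A => ⟨Equiv.refl _, rfl, fun _ _ _ => Iff.rfl, fun _ => rfl⟩
      symm := by
        rintro A B ⟨e, h0, h1, h2⟩
        refine ⟨e.symm, by simp [← h0], fun s a b => by simp [h1], fun a => ?_⟩
        rw [← h2, e.apply_symm_apply]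
      trans := by
        rintro A B C ⟨e, h0, h1, h2⟩ ⟨f, k0, k1, k2⟩
        exact ⟨e.trans f, by simp [h0, k0], fun s a b => by simp [h1, k1],
          fun a => by simp [h2, k2]⟩ }

/-- Isomorphism classes of rooted, edge labeled, `Q`-vertex labeled graphs. -/
abbrev LabeledClass (Q : Type) : Type 1 := Quotient (RootedLabeled.setoid Q)

section Balls

variable {V : Type} [AddAction ℤ V]

/-- The vertices at distance at most `r` from `x` in the Schreier graph of the `ℤ`-set `V`: there
is an `s`-labeled edge from `y` to `s +ᵥ y` for every vertex `y` and every generator `s`. -/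
def ballSet : ℕ → V → Set V
  | 0, x => {x}
  | r + 1, x => {z | z ∈ ballSet r x ∨ ∃ y ∈ ballSet r x, ∃ s : Gen, (s : ℤ) +ᵥ y = z}

theorem mem_ballSet_self (r : ℕ) (x : V) : x ∈ ballSet r x := by
  induction r with
  | zero => exact rfl
  | succ r ih => exact Or.inl ih

/-- The rooted labeled ball of radius `r` around `x`, as an induced subgraph. -/
def ballAt {Q : Type} (r : ℕ) (φ : V → Q) (x : V) : RootedLabeled Q where
  Vert := ballSet r x
  root := ⟨x, mem_ballSet_self r x⟩
  edge := fun s a b => (s : ℤ) +ᵥ (a : V) = b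
  label := fun a => φ a

/-- `Conf_r(φ)`: the isomorphism classes of the labeled `r`-balls that occur in `(V, φ)`. -/
def Conf {Q : Type} (r : ℕ) (φ : V → Q) : Set (LabeledClass Q) :=
  {c | ∃ x : V, c = Quotient.mk _ (ballAt r φ x)}

end Balls

/-- The set `U^{r,Q}` of classes of labeled `r`-balls that occur in some `Q`-labeled Schreier
graph `S(ℤ, H)` on the coset space `ℤ ⧸ H`. -/
def ballClasses (r : ℕ) (Q : Type) : Set (LabeledClass Q) :=
  {c | ∃ (H : AddSubgroup ℤ) (φ : ℤ ⧸ H → Q), c ∈ Conf r φ}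

/-! ### Generalized Schreier graphs and qualitative convergence -/

/-- A generalized Schreier graph of `ℤ`: the graph of an action of `ℤ` on a countable set. -/
structure GenSchreierGraph where
  Vert : Type
  [countable : Countable Vert]
  [action : AddAction ℤ Vert]

attribute [instance] GenSchreierGraph.countable GenSchreierGraph.action

/-- The cyclic Schreier graph `C_n` on `ℤ / nℤ` (meant for `n ≥ 1`), with a `1`-labeled edge from
`a` to `a + 1` and a `-1`-labeled edge from `a` to `a - 1`. -/
def cyclicGraph (n : ℕ) : GenSchreierGraph :=
  { Vert := ZMod n
    countable := by
      cases n with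
      | zero => exact inferInstanceAs (Countable ℤ)
      | succ n => exact inferInstanceAs (Countable (Fin (n + 1)))
    action := AddAction.compHom (ZMod n) (Int.castAddHom (ZMod n)) }

/-- Qualitative convergence of a sequence of generalized Schreier graphs. -/
def QualitativelyConvergent (S : ℕ → GenSchreierGraph) : Prop :=
  ∀ (Q : Type) [Finite Q] (r : ℕ), 1 ≤ r → ∀ A : Set (LabeledClass Q), A ⊆ ballClasses r Q →
    ∃ N : ℕ,
      (∀ n ≥ N, ∃ φ : (S n).Vert → Q, Conf r φ = A) ∨
      (∀ n ≥ N, ¬ ∃ φ : (S n).Vert → Q, Conf r φ = A)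

/-! ### Actions of `ℤ` -/

/-- The action of `ℤ` on `X` is free. -/
def IsFreeAction (X : Type) [AddAction ℤ X] : Prop :=
  ∀ (m : ℤ) (x : X), m +ᵥ x = x → m = 0

/-- The action of `ℤ` on `X` is stable: whatever fixes a point fixes a neighbourhood of it. -/
def IsStableAction (X : Type) [TopologicalSpace X] [AddAction ℤ X] : Prop :=
  ∀ (m : ℤ) (x : X), m +ᵥ x = x → ∀ᶠ y in 𝓝 x, m +ᵥ y = y

/-- The qualitatively convergent sequence `S` converges qualitatively to the stable action of `ℤ`
on `X`. -/
def IsQualitativeLimit (S : ℕ → GenSchreierGraph) (X : Type) [TopologicalSpace X]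
    [AddAction ℤ X] : Prop :=
  QualitativelyConvergent S ∧ IsStableAction X ∧
  ∀ (Q : Type) [Finite Q] [TopologicalSpace Q] [DiscreteTopology Q] (r : ℕ), 1 ≤ r →
    ∀ A : Set (LabeledClass Q), A ⊆ ballClasses r Q →
      ((∃ ψ : X → Q, Continuous ψ ∧ Conf r ψ = A) ↔
        ∃ N : ℕ, ∀ n ≥ N, ∃ φ : (S n).Vert → Q, Conf r φ = A)

/-- The periodic spectrum: all `n ≥ 1` for which some clopen `U` has translates
`U, 1 +ᵥ U, …, (n - 1) +ᵥ U` that partition `X`. -/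
def periodicSpectrum (X : Type) [TopologicalSpace X] [AddAction ℤ X] : Set ℕ :=
  {n | 0 < n ∧ ∃ U : Set X, IsClopen U ∧
    (⋃ i : Fin n, (fun x : X => ((i : ℕ) : ℤ) +ᵥ x) '' U) = Set.univ ∧
    Pairwise fun i j : Fin n =>
      Disjoint ((fun x : X => ((i : ℕ) : ℤ) +ᵥ x) '' U) ((fun x : X => ((j : ℕ) : ℤ) +ᵥ x) '' U)}

/-! ### Arithmetic of the sequence -/

/-- A set of positive integers that contains every divisor of each of its elements. -/
def DivisionClosed (W : Set ℕ) : Prop :=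
  (∀ n ∈ W, 0 < n) ∧ ∀ n ∈ W, ∀ m : ℕ, m ∣ n → m ∈ W

/-- The arithmetic spectrum: the `m ≥ 1` that divide all but finitely many terms. -/
def arithmeticSpectrum (ρ : ℕ → ℕ) : Set ℕ :=
  {m | 0 < m ∧ ∀ᶠ k in Filter.atTop, m ∣ ρ k}

end QualLimit

/-! In a `ℤ`-set without periods of size at most `2 * r + 1`, an `r`-ball is a labeled path on `[-r,
r]`, so a labeling with configuration set `A` is an equivariant walk through the finite graph of
windows whose range is exactly `S = windowClass ⁻¹' A` (`exists_conf_eq_iff`). On `C_n`, for large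
`n`, such a walk is a closed walk of length `n` covering `S`.

Fix `s ∈ S` and let `p` be the gcd of the lengths of closed covering walks at `s`. These lengths are
closed under addition, hence contain every large multiple of `p`. So almost all `C_{n_k}` carry a
walk iff `p` divides almost all `n_k`. On a free minimal Cantor system a continuous walk exists iff
`p` is in the periodic spectrum: visits to `s` happen at times congruent mod `p`, which gives a
factor `ℤ/p` (`setGcd_coverLengths_mem_periodicSpectrum`); conversely, inside a fibre of such a
factor one finds a small clopen set whose return times are large multiples of `p`, and closed
covering walks fill the return towers (`exists_equivariant_walk`). Equality of the two spectra is
therefore all that is needed.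

For existence, `W` contains `1` and is closed under lcm, being an arithmetic spectrum. The orbit
closure of an array recording divisibility by each `w ∈ W` and a coding of the rotation by `√2` is
minimal with spectrum `W`; the irrational row makes it free without adding finite factors. Brouwer's
theorem then moves the action to the Cantor set. -/

namespace QualLimit

/-! ### Brouwer's characterization of the Cantor set -/

section Brouwer

variable {X : Type}

open Classical in
/-- The cell of level `n` with address `b`, for the splitting rule `D`. -/
noncomputable def cell (D : ℕ → Set X → Set X) (b : ℕ → Bool) : ℕ → Set X
  | 0 => Set.univ
  | n + 1 => if b n then cell D b n ∩ D n (cell D b n) else cell D b n \ D n (cell D b n)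

open Classical in
/-- The cell of level `n` that contains `x`, for the splitting rule `D`. -/
noncomputable def cellOf (D : ℕ → Set X → Set X) (x : X) : ℕ → Set X
  | 0 => Set.univ
  | n + 1 => if x ∈ D n (cellOf D x n) then cellOf D x n ∩ D n (cellOf D x n)
      else cellOf D x n \ D n (cellOf D x n)

open Classical in
/-- The address of `x`, for the splitting rule `D`. -/
noncomputable def address (D : ℕ → Set X → Set X) (x : X) (n : ℕ) : Bool :=
  decide (x ∈ D n (cellOf D x n))

theorem mem_cellOf (D : ℕ → Set X → Set X) (x : X) (n : ℕ) : x ∈ cellOf D x n := by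
  induction n with
  | zero => exact Set.mem_univ _
  | succ n ih =>
    rw [cellOf]
    split_ifs with h
    · exact ⟨ih, h⟩
    · exact ⟨ih, h⟩

theorem cell_address (D : ℕ → Set X → Set X) (x : X) (n : ℕ) :
    cell D (address D x) n = cellOf D x n := by
  induction n with
  | zero => rfl
  | succ n ih =>
    rw [cell, cellOf, ih]
    by_cases h : x ∈ D n (cellOf D x n) <;> simp [address, h]

theorem cell_succ_subset (D : ℕ → Set X → Set X) (b : ℕ → Bool) (n : ℕ) :
    cell D b (n + 1) ⊆ cell D b n := by
  rw [cell]
  split_ifs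
  · exact Set.inter_subset_left
  · exact Set.sdiff_subset

theorem cellOf_eq_cell (D : ℕ → Set X → Set X) (b : ℕ → Bool) (x : X) (n : ℕ)
    (h : x ∈ cell D b n) : cellOf D x n = cell D b n := by
  induction n with
  | zero => rfl
  | succ n ih =>
    have h1 := ih (cell_succ_subset D b n h)
    rw [cell] at h
    rw [cellOf, cell, h1]
    by_cases hb : b n = true
    · rw [if_pos hb] at h ⊢
      exact if_pos h.2
    · rw [if_neg hb] at h ⊢
      exact if_neg h.2

theorem address_eq (D : ℕ → Set X → Set X) (b : ℕ → Bool) (x : X) (n : ℕ)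
    (h : x ∈ cell D b (n + 1)) : address D x n = b n := by
  have h1 := cellOf_eq_cell D b x n (cell_succ_subset D b n h)
  rw [cell] at h
  rw [address, h1]
  split_ifs at h with hb
  · simp [hb, h.2]
  · simpa [hb] using h.2

/-- A nonempty compact Hausdorff totally disconnected space without isolated points whose points
are separated by countably many clopen sets is homeomorphic to the Cantor set. -/
theorem nonempty_homeomorph_cantor [TopologicalSpace X] [CompactSpace X] [T2Space X] [TotallyDisconnectedSpace X]
    [Nonempty X] (U : ℕ → Set X) (hU : ∀ n, IsClopen (U n))
    (hsep : ∀ x y, (∀ n, x ∈ U n ↔ y ∈ U n) → x = y) (hperf : ∀ x : X, ¬ IsOpen {x}) :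
    Nonempty (X ≃ₜ Cantor) := by
  -- Both halves must be nonempty, for surjectivity of the address map; after level `n` each cell
  -- lies inside or outside `U n`, for injectivity.
  have split : ∀ (n : ℕ) (C : Set X), ∃ D : Set X, IsClopen C → C.Nonempty →
      IsClopen D ∧ (C ∩ D).Nonempty ∧ (C \ D).Nonempty ∧
        (C ⊆ U n ∨ Disjoint C (U n) ∨ D = U n) := by
    intro n C
    by_cases hC : IsClopen C ∧ C.Nonempty
    swap
    · exact ⟨∅, fun h1 h2 => absurd ⟨h1, h2⟩ hC⟩
    -- If `U n` does not cut `C`, any clopen set separating two points of `C` serves; a second point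
    -- exists because no point is isolated.
    by_cases h1 : C ⊆ U n ∨ Disjoint C (U n)
    · obtain ⟨hC, x, hx⟩ := hC
      have : ∃ y ∈ C, y ≠ x := by
        by_contra! hne
        apply hperf x
        have : C = {x} := Set.eq_singleton_iff_unique_mem.2 ⟨hx, hne⟩
        exact this ▸ hC.isOpen
      obtain ⟨y, hy, hyx⟩ := this
      obtain ⟨D, hD, hxD, hDy⟩ := compact_exists_isClopen_in_isOpen (isOpen_compl_singleton (x := y))
        (show x ∈ ({y} : Set X)ᶜ from fun h => hyx (Set.mem_singleton_iff.1 h).symm)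
      refine ⟨D, fun _ _ => ⟨hD, ⟨x, hx, hxD⟩, ⟨y, hy, fun h => hDy h rfl⟩, ?_⟩⟩
      tauto
    · push Not at h1
      obtain ⟨x, hx, hxU⟩ := Set.not_subset.1 h1.1
      exact ⟨U n, fun _ _ => ⟨hU n, Set.not_disjoint_iff_nonempty_inter.1 h1.2, ⟨x, hx, hxU⟩,
        Or.inr (Or.inr rfl)⟩⟩
  choose D hD using split
  have hcell : ∀ b n, IsClopen (cell D b n) ∧ (cell D b n).Nonempty := by
    intro b n
    induction n with
    | zero => exact ⟨isClopen_univ, Set.univ_nonempty⟩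
    | succ n ih =>
      obtain ⟨h1, h2, h3, -⟩ := hD n _ ih.1 ih.2
      rw [cell]
      split_ifs
      · exact ⟨ih.1.inter h1, h2⟩
      · exact ⟨ih.1.diff h1, h3⟩
  have hcont : Continuous (address D) := by
    refine continuous_pi fun n => continuous_discrete_rng.2 fun v => ?_
    refine isOpen_iff_mem_nhds.2 fun x hx => ?_
    have hx' : address D x n = v := hx
    refine Filter.mem_of_superset ((hcell (address D x) (n + 1)).1.isOpen.mem_nhds ?_)
      fun y hy => ?_
    · rw [cell_address]
      exact mem_cellOf D x _
    · exact (address_eq D _ y n hy).trans hx'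
  have hinj : Function.Injective (address D) := by
    intro x y hxy
    refine hsep x y fun n => ?_
    have hx : x ∈ cell D (address D x) (n + 1) := by
      rw [cell_address]; exact mem_cellOf D x _
    have hy : y ∈ cell D (address D x) (n + 1) := by
      rw [hxy, cell_address]; exact mem_cellOf D y _
    obtain ⟨-, -, -, h | h | h⟩ := hD n _ (hcell (address D x) n).1 (hcell (address D x) n).2
    · exact ⟨fun _ => h (cell_succ_subset _ _ _ hy), fun _ => h (cell_succ_subset _ _ _ hx)⟩
    · exact ⟨fun h' => absurd h' (Set.disjoint_left.1 h (cell_succ_subset _ _ _ hx)),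
        fun h' => absurd h' (Set.disjoint_left.1 h (cell_succ_subset _ _ _ hy))⟩
    · rw [cell, h] at hx hy
      split_ifs at hx hy
      · exact ⟨fun _ => hy.2, fun _ => hx.2⟩
      · exact ⟨fun h' => absurd h' hx.2, fun h' => absurd h' hy.2⟩
  have hsurj : Function.Surjective (address D) := by
    intro b
    obtain ⟨x, hx⟩ := IsCompact.nonempty_iInter_of_sequence_nonempty_isCompact_isClosed
      (cell D b) (cell_succ_subset D b) (fun n => (hcell b n).2)
      (hcell b 0).1.isClosed.isCompact fun n => (hcell b n).1.isClosed
    exact ⟨x, funext fun n => address_eq D b x n (Set.mem_iInter.1 hx (n + 1))⟩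
  exact ⟨Continuous.homeoOfEquivCompactToT2
    (f := Equiv.ofBijective (address D) ⟨hinj, hsurj⟩) hcont⟩

end Brouwer

/-! ### The periodic spectrum -/

section Spectrum

variable {X : Type} [TopologicalSpace X] [AddAction ℤ X] [ContinuousConstVAdd ℤ X]

theorem map_vadd_of_map_one_vadd {X : Type} [AddAction ℤ X] {n : ℕ} {f : X → ZMod n}
    (hf : ∀ x, f ((1 : ℤ) +ᵥ x) = f x + 1)
    (m : ℤ) (x : X) : f (m +ᵥ x) = f x + m := by
  induction m with
  | zero => simp
  | succ m ih =>
    rw [add_comm (m : ℤ) 1, add_vadd, hf, ih]; push_cast; ring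
  | pred m ih =>
    have := hf ((-(m : ℤ) - 1) +ᵥ x)
    rw [vadd_vadd, show (1 : ℤ) + (-m - 1) = -m by ring, ih] at this
    rw [← sub_eq_iff_eq_add] at this
    rw [← this]; push_cast; ring

/-- `n` is in the periodic spectrum iff the rotation of `ℤ / n` is a factor of the action. -/
theorem mem_periodicSpectrum_iff {n : ℕ} :
    n ∈ periodicSpectrum X ↔
      0 < n ∧ ∃ f : X → ZMod n, Continuous f ∧ ∀ x, f ((1 : ℤ) +ᵥ x) = f x + 1 := by
  have hmem : ∀ (i : ℕ) (U : Set X) (x : X),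
      x ∈ (fun x : X => (i : ℤ) +ᵥ x) '' U ↔ (-(i : ℤ)) +ᵥ x ∈ U := by
    intro i U x
    constructor
    · rintro ⟨y, hy, rfl⟩
      simpa [vadd_vadd] using hy
    · intro h
      exact ⟨_, h, by simp [vadd_vadd]⟩
  constructor
  · rintro ⟨hn, U, hU, hcov, hdis⟩
    refine ⟨hn, ?_⟩
    have hex : ∀ x : X, ∃ i : Fin n, (-(i : ℤ)) +ᵥ x ∈ U := by
      intro x
      obtain ⟨i, hi⟩ := Set.mem_iUnion.1 (hcov ▸ Set.mem_univ x)
      exact ⟨i, (hmem i U x).1 hi⟩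
    have huniq : ∀ (x : X) (i j : Fin n), (-(i : ℤ)) +ᵥ x ∈ U → (-(j : ℤ)) +ᵥ x ∈ U → i = j := by
      intro x i j hi hj
      by_contra hij
      exact Set.disjoint_left.1 (hdis hij) ((hmem i U x).2 hi) ((hmem j U x).2 hj)
    choose k hk using hex
    refine ⟨fun x => ((k x : ℕ) : ZMod n), ?_, ?_⟩
    · have : Continuous k := by
        refine continuous_discrete_rng.2 fun i => ?_
        have : k ⁻¹' {i} = (fun x : X => (-(i : ℤ)) +ᵥ x) ⁻¹' U := by
          ext x
          exact ⟨fun h => by have h' : k x = i := h; exact h' ▸ hk x,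
            fun h => huniq x _ _ (hk x) h⟩
        rw [this]
        exact hU.isOpen.preimage (continuous_const_vadd _)
      exact (continuous_of_discreteTopology (f := fun i : Fin n => ((i : ℕ) : ZMod n))).comp this
    · intro x
      beta_reduce
      have h1 := hk ((1 : ℤ) +ᵥ x)
      rw [vadd_vadd] at h1
      -- Wrapping from the top translate to the bottom one is the only case where the index does not
      -- grow by one.
      by_cases h0 : (k ((1 : ℤ) +ᵥ x) : ℕ) = 0
      · have hlast : (k x : ℕ) + 1 = n := by
          by_contra hne
          have hlt : (k x : ℕ) + 1 < n := by have := (k x).2; omega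
          have := huniq ((1 : ℤ) +ᵥ x) ⟨k x + 1, hlt⟩ (k ((1 : ℤ) +ᵥ x)) (by
            rw [vadd_vadd]
            have := hk x
            push_cast
            rwa [show -((k x : ℤ) + 1) + 1 = -(k x : ℤ) by ring]) (hk _)
          rw [← this] at h0
          simp at h0
        rw [h0, ← Nat.cast_add_one, hlast]; simp
      · have hlt : (k ((1 : ℤ) +ᵥ x) : ℕ) - 1 < n := by
          have := (k ((1 : ℤ) +ᵥ x)).2; omega
        have := huniq x (k x) ⟨_, hlt⟩ (hk x) (by
          convert h1 using 2
          push_cast [Nat.cast_sub (Nat.one_le_iff_ne_zero.2 h0)]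
          ring)
        have h2 : (k x : ℕ) + 1 = k ((1 : ℤ) +ᵥ x) := by
          rw [this]; simp only; omega
        rw [← h2]; push_cast; ring
  · rintro ⟨hn, f, hf, hf1⟩
    have : NeZero n := ⟨hn.ne'⟩
    refine ⟨hn, f ⁻¹' {0}, (isClopen_discrete _).preimage hf, ?_, ?_⟩
    · refine Set.eq_univ_of_forall fun x => Set.mem_iUnion.2
        ⟨⟨(f x).val, ZMod.val_lt _⟩, (hmem _ _ _).2 ?_⟩
      simp [map_vadd_of_map_one_vadd hf1]
    · intro i j hij
      refine Set.disjoint_left.2 fun x hi hj => hij ?_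
      rw [hmem] at hi hj
      simp only [Set.mem_preimage, Set.mem_singleton_iff, map_vadd_of_map_one_vadd hf1] at hi hj
      have := hi.trans hj.symm
      push_cast at this
      have h2 : ((i : ℕ) : ZMod n) = (j : ℕ) := by
        simpa using this
      rw [ZMod.natCast_eq_natCast_iff', Nat.mod_eq_of_lt i.2, Nat.mod_eq_of_lt j.2] at h2
      exact Fin.ext h2

end Spectrum

/-! ### Balls without periods are windows -/

section Windows

/-- Labelings of the integer interval `[-r, r]`. -/
abbrev Window (r : ℕ) (Q : Type) : Type := Set.Icc (-(r : ℤ)) r → Q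

/-- The labeled path on `[-r, r]`, rooted at `0`. -/
def windowGraph {r : ℕ} {Q : Type} (u : Window r Q) : RootedLabeled Q where
  Vert := Set.Icc (-(r : ℤ)) r
  root := ⟨0, by simp⟩
  edge := fun s a b => (s : ℤ) + a = b
  label := u

/-- The isomorphism class of a labeled path. -/
def windowClass {r : ℕ} {Q : Type} (u : Window r Q) : LabeledClass Q :=
  Quotient.mk _ (windowGraph u)

/-- The window `u'` can follow the window `u` in a labeled orbit. -/
def Follows {r : ℕ} {Q : Type} (u u' : Window r Q) : Prop :=
  ∀ i j : Set.Icc (-(r : ℤ)) r, (j : ℤ) = i + 1 → u' i = u j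

/-- Paths are rigid: the root is fixed and the labeled edges force the image of each next vertex, so
an isomorphism is the identity on `[-r, r]`. -/
theorem windowClass_injective (r : ℕ) (Q : Type) :
    Function.Injective (windowClass (r := r) (Q := Q)) := by
  intro u v huv
  obtain ⟨(e : Set.Icc (-(r : ℤ)) r ≃ Set.Icc (-(r : ℤ)) r), h0, h1, h2⟩ := Quotient.exact huv
  have hpos : ∀ (k : ℕ) (hk : (k : ℤ) ∈ Set.Icc (-(r : ℤ)) r), e ⟨k, hk⟩ = ⟨k, hk⟩ := by
    intro k
    induction k with
    | zero => intro hk; exact h0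
    | succ k ih =>
      intro hk
      have hk' : (k : ℤ) ∈ Set.Icc (-(r : ℤ)) r := by
        rw [Set.mem_Icc] at hk ⊢; push_cast at hk; omega
      have : ((1 : ℤ) + e ⟨k, hk'⟩ : ℤ) =
          e ⟨(k + 1 : ℕ), hk⟩ :=
        (h1 ⟨1, Or.inl rfl⟩ ⟨k, hk'⟩ ⟨(k + 1 : ℕ), hk⟩).1
          (show (1 : ℤ) + (k : ℤ) = ((k + 1 : ℕ) : ℤ) by push_cast; ring)
      rw [ih hk'] at this
      refine Subtype.ext (this.symm.trans ?_)
      push_cast; ring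
  have hneg : ∀ (k : ℕ) (hk : (-(k : ℤ)) ∈ Set.Icc (-(r : ℤ)) r), e ⟨-k, hk⟩ = ⟨-k, hk⟩ := by
    intro k
    induction k with
    | zero => intro hk; exact h0
    | succ k ih =>
      intro hk
      have hk' : (-(k : ℤ)) ∈ Set.Icc (-(r : ℤ)) r := by
        rw [Set.mem_Icc] at hk ⊢; push_cast at hk; omega
      have : ((-1 : ℤ) + e ⟨-k, hk'⟩ : ℤ) =
          e ⟨-(k + 1 : ℕ), hk⟩ :=
        (h1 ⟨-1, Or.inr rfl⟩ ⟨-k, hk'⟩ ⟨-(k + 1 : ℕ), hk⟩).1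
          (show (-1 : ℤ) + (-(k : ℤ)) = -((k + 1 : ℕ) : ℤ) by push_cast; ring)
      rw [ih hk'] at this
      refine Subtype.ext (this.symm.trans ?_)
      push_cast; ring
  funext i
  have hi : e i = i := by
    obtain ⟨i, hi⟩ := i
    obtain ⟨k, rfl | rfl⟩ := i.eq_nat_or_neg
    · exact hpos k hi
    · exact hneg k hi
  have : v (e i) = u i := h2 i
  rw [hi] at this
  exact this.symm

variable {V : Type} [AddAction ℤ V]

theorem mem_ballSet_iff {r : ℕ} {x z : V} :
    z ∈ ballSet r x ↔ ∃ i ∈ Set.Icc (-(r : ℤ)) r, i +ᵥ x = z := by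
  induction r generalizing z with
  | zero =>
    constructor
    · rintro rfl
      exact ⟨0, by simp, zero_vadd _ _⟩
    · rintro ⟨i, hi, rfl⟩
      have : i = 0 := by simpa using hi
      subst this
      exact zero_vadd _ _
  | succ r ih =>
    constructor
    · rintro (h | ⟨y, hy, s, rfl⟩)
      · obtain ⟨i, hi, rfl⟩ := ih.1 h
        refine ⟨i, ?_, rfl⟩
        rw [Set.mem_Icc] at hi ⊢; push_cast; omega
      · obtain ⟨i, hi, rfl⟩ := ih.1 hy
        refine ⟨s + i, ?_, add_vadd _ _ _⟩
        rw [Set.mem_Icc] at hi ⊢; push_cast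
        obtain ⟨s, rfl | rfl⟩ := s <;> simp only <;> omega
    · rintro ⟨i, hi, rfl⟩
      rw [Set.mem_Icc] at hi; push_cast at hi
      by_cases h1 : i = r + 1
      · refine Or.inr ⟨(r : ℤ) +ᵥ x, ih.2 ⟨r, by rw [Set.mem_Icc]; omega, rfl⟩, ⟨1, Or.inl rfl⟩, ?_⟩
        rw [vadd_vadd, h1, add_comm]
      by_cases h2 : i = -(r + 1)
      · refine Or.inr ⟨(-r : ℤ) +ᵥ x, ih.2 ⟨-r, by rw [Set.mem_Icc]; omega, rfl⟩,
          ⟨-1, Or.inr rfl⟩, ?_⟩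
        rw [vadd_vadd, h2]; congr 1; ring
      · exact Or.inl (ih.2 ⟨i, by rw [Set.mem_Icc]; omega, rfl⟩)

/-- The window of radius `r` seen from `x`. -/
def windowAt {Q : Type} (r : ℕ) (φ : V → Q) (x : V) : Window r Q := fun i => φ ((i : ℤ) +ᵥ x)

/-- The bound `2 * r + 1` excludes both coincidences of vertices (differences up to `2 * r`) and
extra edges between ball points (one generator more). -/
theorem mk_ballAt_eq_windowClass {Q : Type} {r : ℕ} (φ : V → Q) {x : V}
    (hx : ∀ m : ℤ, |m| ≤ 2 * r + 1 → m +ᵥ x = x → m = 0) :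
    (Quotient.mk _ (ballAt r φ x) : LabeledClass Q) = windowClass (windowAt r φ x) := by
  have heq : ∀ m n : ℤ, |m - n| ≤ 2 * r + 1 → m +ᵥ x = n +ᵥ x → m = n := by
    intro m n h1 h2
    refine sub_eq_zero.1 (hx _ h1 ?_)
    rw [sub_eq_neg_add, add_vadd, h2, vadd_vadd]; simp
  symm
  apply Quotient.sound
  let e : Set.Icc (-(r : ℤ)) r → ballSet r x := fun i => ⟨(i : ℤ) +ᵥ x, mem_ballSet_iff.2 ⟨i, i.2, rfl⟩⟩
  have he : Function.Bijective e := by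
    constructor
    · rintro ⟨i, hi⟩ ⟨j, hj⟩ hij
      refine Subtype.ext (heq i j ?_ (Subtype.ext_iff.1 hij))
      rw [Set.mem_Icc] at hi hj
      rw [abs_le]; omega
    · rintro ⟨z, hz⟩
      obtain ⟨i, hi, rfl⟩ := mem_ballSet_iff.1 hz
      exact ⟨⟨i, hi⟩, rfl⟩
  refine ⟨Equiv.ofBijective e he, Subtype.ext (zero_vadd _ _), ?_, fun _ => rfl⟩
  rintro s ⟨a, ha⟩ ⟨b, hb⟩
  change (s : ℤ) + a = b ↔ (s : ℤ) +ᵥ (a +ᵥ x) = b +ᵥ x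
  rw [vadd_vadd]
  constructor
  · rintro rfl; rfl
  · refine heq _ _ ?_
    rw [Set.mem_Icc] at ha hb
    rw [abs_le]
    obtain ⟨s, rfl | rfl⟩ := s <;> simp only <;> omega

theorem conf_eq_image_windowClass {Q : Type} {r : ℕ} (φ : V → Q)
    (hV : ∀ (x : V) (m : ℤ), |m| ≤ 2 * r + 1 → m +ᵥ x = x → m = 0) :
    Conf r φ = windowClass '' Set.range (windowAt r φ) := by
  ext c
  rw [← Set.range_comp]
  constructor
  · rintro ⟨x, rfl⟩
    exact ⟨x, (mk_ballAt_eq_windowClass φ (hV x)).symm⟩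
  · rintro ⟨x, rfl⟩
    exact ⟨x, (mk_ballAt_eq_windowClass φ (hV x)).symm⟩

/-- Overlap of consecutive windows carries entry `i` of `g x` to the centre of `g (i +ᵥ x)`, so a
walk is recovered from its central letters. -/
theorem windowAt_eq_of_follows {Q : Type} {r : ℕ} {g : V → Window r Q}
    (hg : ∀ x, Follows (g x) (g ((1 : ℤ) +ᵥ x))) :
    windowAt r (fun x => g x ⟨0, by simp⟩) = g := by
  have key : ∀ (k : ℕ) (x : V) (i j : Set.Icc (-(r : ℤ)) r), (j : ℤ) = i + k →
      g ((k : ℤ) +ᵥ x) i = g x j := by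
    intro k
    induction k with
    | zero =>
      intro x i j h
      have : j = i := Subtype.ext (by simpa using h)
      simp [this]
    | succ k ih =>
      intro x i j h
      have hi := i.2
      have hj := j.2
      rw [Set.mem_Icc] at hi hj
      push_cast at h
      have hmem : (i : ℤ) + 1 ∈ Set.Icc (-(r : ℤ)) r := by rw [Set.mem_Icc]; omega
      have h1 := hg ((k : ℤ) +ᵥ x) i ⟨i + 1, hmem⟩ rfl
      rw [ih x ⟨i + 1, hmem⟩ j (by simp only; omega), vadd_vadd] at h1
      rw [← h1]
      congr 2
      push_cast; ring
  funext x i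
  change g ((i : ℤ) +ᵥ x) ⟨0, by simp⟩ = g x i
  obtain ⟨i, hi⟩ := i
  obtain ⟨k, rfl | rfl⟩ := i.eq_nat_or_neg
  · exact key k x _ _ (by simp)
  · have := key k (-(k : ℤ) +ᵥ x) ⟨-k, hi⟩ ⟨0, by simp⟩ (by simp)
    rw [← this, vadd_vadd]; simp

/-- On a `ℤ`-set without short periods, labelings with a given configuration set correspond to
equivariant walks through the windows. -/
theorem exists_conf_eq_iff [TopologicalSpace V] [ContinuousConstVAdd ℤ V] {Q : Type}
    [TopologicalSpace Q] {r : ℕ}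
    (hV : ∀ (x : V) (m : ℤ), |m| ≤ 2 * r + 1 → m +ᵥ x = x → m = 0) (A : Set (LabeledClass Q)) :
    (∃ φ : V → Q, Continuous φ ∧ Conf r φ = A) ↔
      A ⊆ Set.range (windowClass (r := r)) ∧ ∃ g : V → Window r Q, Continuous g ∧
        Set.range g = windowClass ⁻¹' A ∧ ∀ x, Follows (g x) (g ((1 : ℤ) +ᵥ x)) := by
  constructor
  · rintro ⟨φ, hφ, rfl⟩
    rw [conf_eq_image_windowClass φ hV]
    refine ⟨Set.image_subset_range _ _, windowAt r φ,
      continuous_pi fun i => hφ.comp (continuous_const_vadd _), ?_, ?_⟩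
    · rw [Set.preimage_image_eq _ (windowClass_injective r Q)]
    · intro x i j hij
      simp [windowAt, vadd_vadd, hij]
  · rintro ⟨hA, g, hg, hgA, hgF⟩
    refine ⟨fun x => g x ⟨0, by simp⟩, (continuous_pi_iff.1 hg) _, ?_⟩
    rw [conf_eq_image_windowClass _ hV, windowAt_eq_of_follows hgF, hgA,
      Set.image_preimage_eq_of_subset hA]

end Windows

/-! ### Closed covering walks -/

section Walks

variable {M : Type} (R : M → M → Prop) (S : Set M) (s : M)

/-- The lengths of closed walks at `s` that visit exactly the vertices in `S`. -/
def coverLengths : Set ℕ :=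
  {n | 0 < n ∧ ∃ c : ℕ → M, c 0 = s ∧ c n = s ∧ (∀ i < n, R (c i) (c (i + 1))) ∧
    c '' Set.Iio n = S}

variable {R S s}

/-- Concatenation of loops; the first loop only has to stay in `S`, since the second already covers
it. -/
theorem add_mem_coverLengths {l n : ℕ} {d : ℕ → M} (h0 : d 0 = s) (hl : d l = s)
    (hd : ∀ i < l, R (d i) (d (i + 1))) (hS : ∀ i < l, d i ∈ S) (hn : n ∈ coverLengths R S s) :
    l + n ∈ coverLengths R S s := by
  obtain ⟨hn0, c, c0, cn, hc, hcS⟩ := hn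
  refine ⟨by omega, fun i => if i < l then d i else c (i - l), ?_, ?_, ?_, ?_⟩
  · dsimp only
    split_ifs with h
    · exact h0
    · simpa using c0
  · simpa using cn
  · intro i hi
    dsimp only
    by_cases h1 : i + 1 < l
    · rw [if_pos h1, if_pos (by omega)]
      exact hd i (by omega)
    by_cases h2 : i < l
    · have h3 : i + 1 = l := by omega
      rw [if_pos h2, if_neg h1, h3, Nat.sub_self, c0, ← hl, ← h3]
      exact hd i h2
    · rw [if_neg h2, if_neg h1, Nat.sub_add_comm (by omega)]
      exact hc _ (by omega)
  · apply Set.Subset.antisymm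
    · rintro _ ⟨i, hi, rfl⟩
      have hi' : i < l + n := hi
      dsimp only
      split_ifs with h
      · exact hS i h
      · rw [← hcS]
        exact ⟨i - l, show i - l < n by omega, rfl⟩
    · rw [← hcS]
      rintro _ ⟨i, hi, rfl⟩
      have hi' : i < n := hi
      exact ⟨l + i, show l + i < l + n by omega, by simp⟩

theorem mem_coverLengths_of_mem_closure {n : ℕ}
    (hn : n ∈ AddSubmonoid.closure (coverLengths R S s)) (h0 : n ≠ 0) :
    n ∈ coverLengths R S s := by
  have : n = 0 ∨ n ∈ coverLengths R S s := by
    clear h0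
    induction hn using AddSubmonoid.closure_induction with
    | mem x hx => exact Or.inr hx
    | zero => exact Or.inl rfl
    | add x y _ _ hx hy =>
      rcases hx with rfl | hx
      · simpa using hy
      rcases hy with rfl | hy
      · exact Or.inr (by simpa using hx)
      obtain ⟨_, c, c0, cn, hc, hcS⟩ := hx
      exact Or.inr (add_mem_coverLengths c0 cn hc (fun i hi => hcS ▸ ⟨i, hi, rfl⟩) hy)
  exact this.resolve_left h0

theorem exists_forall_ge_mem_coverLengths (R : M → M → Prop) (S : Set M) (s : M) :
    ∃ N, ∀ n ≥ N, Nat.setGcd (coverLengths R S s) ∣ n → n ∈ coverLengths R S s := by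
  obtain ⟨N, hN⟩ := Nat.exists_mem_closure_of_ge (coverLengths R S s)
  exact ⟨N + 1, fun n hn hd =>
    mem_coverLengths_of_mem_closure (hN n (by omega) hd) (by omega)⟩

/-- Equivariant walks on a `ℤ`-set give closed covering walks. -/
theorem mem_coverLengths_of_orbit {V : Type} [AddAction ℤ V] {g : V → M}
    (hg : ∀ x, R (g x) (g ((1 : ℤ) +ᵥ x))) (hS : Set.range g = S) {x : V} {n : ℕ} (hn : 0 < n)
    (h0 : g x = s) (h1 : g ((n : ℤ) +ᵥ x) = s)
    (hcov : ∀ t ∈ S, ∃ i < n, g ((i : ℤ) +ᵥ x) = t) : n ∈ coverLengths R S s := by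
  refine ⟨hn, fun i => g ((i : ℤ) +ᵥ x), by simpa using h0, h1, fun i _ => ?_, ?_⟩
  · have := hg ((i : ℤ) +ᵥ x)
    rw [vadd_vadd, add_comm] at this
    simpa using this
  · apply Set.Subset.antisymm
    · rintro _ ⟨i, -, rfl⟩
      exact hS ▸ ⟨_, rfl⟩
    · intro t ht
      obtain ⟨i, hi, h⟩ := hcov t ht
      exact ⟨i, hi, h⟩

/-- A closed covering walk of length `n` gives an equivariant walk on `ℤ / n`. -/
theorem exists_zmod_walk {n : ℕ} (hn : n ∈ coverLengths R S s) :
    ∃ g : ZMod n → M, Set.range g = S ∧ ∀ a, R (g a) (g (1 + a)) := by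
  obtain ⟨hn0, c, c0, cn, hc, hcS⟩ := hn
  have : NeZero n := ⟨hn0.ne'⟩
  refine ⟨fun a => c a.val, ?_, ?_⟩
  · rw [← hcS]
    ext t
    constructor
    · rintro ⟨a, rfl⟩
      exact ⟨a.val, ZMod.val_lt a, rfl⟩
    · rintro ⟨i, hi, rfl⟩
      exact ⟨(i : ZMod n), by simp [ZMod.val_cast_of_lt hi]⟩
  · intro a
    have h1 := hc a.val (ZMod.val_lt a)
    have hcast : ((a.val + 1 : ℕ) : ZMod n) = 1 + a := by
      push_cast; rw [ZMod.natCast_zmod_val, add_comm]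
    beta_reduce
    by_cases h : a.val + 1 = n
    · rw [h] at hcast h1
      rw [← hcast, ZMod.natCast_self, ZMod.val_zero, c0, ← cn]
      exact h1
    · rw [← hcast, ZMod.val_cast_of_lt (by have := ZMod.val_lt a; omega)]
      exact h1

end Walks

/-! ### Walks over minimal actions -/

section Minimal

variable {X : Type} [TopologicalSpace X] [CompactSpace X] [AddAction ℤ X]
  [ContinuousConstVAdd ℤ X] [AddAction.IsMinimal ℤ X]

/-- By compactness finitely many translates of `U` cover `X`, so visits to `U` have bounded gaps in
both time directions. -/
theorem exists_natCast_vadd_mem {U : Set X} (hU : IsOpen U) (hne : U.Nonempty) (x : X) (N : ℕ) :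
    (∃ n ≥ N, (n : ℤ) +ᵥ x ∈ U) ∧ ∃ n ≥ N, (-(n : ℤ)) +ᵥ x ∈ U := by
  obtain ⟨I, hI⟩ := isCompact_univ.exists_finite_cover_vadd ℤ hU hne
  have key : ∀ y : X, ∃ k ∈ I, -k +ᵥ y ∈ U := by
    intro y
    obtain ⟨k, hk, u, hu, rfl⟩ := Set.mem_iUnion₂.1 (hI (Set.mem_univ y))
    exact ⟨k, hk, by simpa [vadd_vadd] using hu⟩
  have hB : ∀ k ∈ I, k.natAbs ≤ ∑ k ∈ I, k.natAbs :=
    fun k hk => Finset.single_le_sum (f := Int.natAbs) (fun _ _ => Nat.zero_le _) hk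
  set B := ∑ k ∈ I, k.natAbs
  constructor
  · obtain ⟨k, hk, h⟩ := key (((N + B : ℕ) : ℤ) +ᵥ x)
    have := hB k hk
    refine ⟨((N + B : ℕ) - k : ℤ).toNat, by omega, ?_⟩
    rw [vadd_vadd] at h
    convert h using 2
    omega
  · obtain ⟨k, hk, h⟩ := key ((-((N + B : ℕ) : ℤ)) +ᵥ x)
    have := hB k hk
    refine ⟨((N + B : ℕ) + k : ℤ).toNat, by omega, ?_⟩
    rw [vadd_vadd] at h
    convert h using 2
    omega

variable {M : Type} [Finite M] [TopologicalSpace M] [DiscreteTopology M] {R : M → M → Prop}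
  {S : Set M} {s : M}

theorem setGcd_coverLengths_mem_periodicSpectrum {g : X → M} (hgc : Continuous g)
    (hg : ∀ x, R (g x) (g ((1 : ℤ) +ᵥ x))) (hS : Set.range g = S) (hs : s ∈ S) :
    Nat.setGcd (coverLengths R S s) ∈ periodicSpectrum X := by
  have hopen : ∀ t, IsOpen (g ⁻¹' {t}) := fun t => (isOpen_discrete _).preimage hgc
  have hvisit : ∀ t ∈ S, ∀ (x : X) (N : ℕ), ∃ n ≥ N, g ((n : ℤ) +ᵥ x) = t := by
    intro t ht x N
    obtain ⟨y, rfl⟩ := hS ▸ ht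
    exact (exists_natCast_vadd_mem (hopen (g y)) ⟨y, rfl⟩ x N).1
  have hlen : ∀ x, g x = s → ∃ B : ℕ, ∀ n : ℕ, B ≤ n → g ((n : ℤ) +ᵥ x) = s →
      n ∈ coverLengths R S s := by
    intro x hx
    have hk : ∀ t : S, ∃ n : ℕ, g ((n : ℤ) +ᵥ x) = t := fun t =>
      (hvisit t t.2 x 0).imp fun _ h => h.2
    choose k hk using hk
    obtain ⟨B, hB⟩ := (Set.finite_range k).bddAbove
    refine ⟨B + 1, fun n hn h => mem_coverLengths_of_orbit hg hS (by omega) hx h fun t ht =>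
      ⟨k ⟨t, ht⟩, ?_, hk ⟨t, ht⟩⟩⟩
    have := hB ⟨⟨t, ht⟩, rfl⟩
    omega
  set p := Nat.setGcd (coverLengths R S s)
  -- A short return need not cover `S`. But for a far later visit at time `m`, both `m` and `m - n`
  -- are covering lengths, and `n` is their difference.
  have hdvd : ∀ (x : X) (n : ℕ), g x = s → g ((n : ℤ) +ᵥ x) = s → p ∣ n := by
    intro x n h0 h1
    obtain ⟨B, hB⟩ := hlen x h0
    obtain ⟨B', hB'⟩ := hlen _ h1
    obtain ⟨m, hm, h2⟩ := hvisit s hs x (B + B' + n)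
    have h3 := hB m (by omega) h2
    have h4 := hB' (m - n) (by omega) (by
      rw [vadd_vadd, ← Nat.cast_add, Nat.sub_add_cancel (by omega)]
      exact h2)
    have h5 := (Nat.dvd_sub_iff_right (show n ≤ m by omega) (Nat.setGcd_dvd_of_mem h3)).1
      (Nat.setGcd_dvd_of_mem h4)
    exact h5
  have hdvd' : ∀ (x : X) (m n : ℤ), g (m +ᵥ x) = s → g (n +ᵥ x) = s → (m : ZMod p) = n := by
    intro x m n hm hn
    wlog h : m ≤ n generalizing m n
    · exact (this n m hn hm (le_of_not_ge h)).symm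
    obtain ⟨k, rfl⟩ := Int.le.dest h
    have := hdvd (m +ᵥ x) k hm (by rwa [vadd_vadd, add_comm])
    push_cast
    rw [(ZMod.natCast_eq_zero_iff k p).2 this, add_zero]
  have hex : ∀ x, ∃ n : ℕ, g ((n : ℤ) +ᵥ x) = s := fun x =>
    (hvisit s hs x 0).imp fun _ h => h.2
  choose n hn using hex
  -- Any visit time computes the factor map. This gives local constancy, as a visit time of `x` also
  -- works near `x`, and equivariance.
  have hf : ∀ (x : X) (m : ℤ), g (m +ᵥ x) = s → -((n x : ℤ) : ZMod p) = -(m : ZMod p) :=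
    fun x m hm => congrArg _ (hdvd' x _ _ (hn x) hm)
  refine mem_periodicSpectrum_iff.2 ⟨?_, fun x => -((n x : ℤ) : ZMod p), ?_, ?_⟩
  · obtain ⟨y, hy⟩ := hS ▸ hs
    obtain ⟨B, hB⟩ := hlen y hy
    obtain ⟨m, hm, h⟩ := hvisit s hs y (B + 1)
    exact Nat.pos_of_dvd_of_pos (Nat.setGcd_dvd_of_mem (hB m (by omega) h)) (by omega)
  · refine ((IsLocallyConstant.iff_eventually_eq _).2 fun x => ?_).continuous
    filter_upwards [((hopen s).preimage (continuous_const_vadd (n x : ℤ))).mem_nhds (hn x)]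
      with y hy
    exact hf y _ hy
  · intro x
    beta_reduce
    rw [hf x (n ((1 : ℤ) +ᵥ x) + 1) (by rw [← vadd_vadd]; exact hn _)]
    push_cast; ring

omit [Finite M] [DiscreteTopology M] in
theorem exists_equivariant_walk [T2Space X] [TotallyDisconnectedSpace X] [Nonempty X]
    (hfree : IsFreeAction X) (hp : Nat.setGcd (coverLengths R S s) ∈ periodicSpectrum X) :
    ∃ g : X → M, Continuous g ∧ Set.range g = S ∧ ∀ x, R (g x) (g ((1 : ℤ) +ᵥ x)) := by
  obtain ⟨N, hN⟩ := exists_forall_ge_mem_coverLengths R S s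
  set p := Nat.setGcd (coverLengths R S s)
  obtain ⟨hp0, f, hfc, hf1⟩ := mem_periodicSpectrum_iff.1 hp
  have hf := map_vadd_of_map_one_vadd hf1
  have : NeZero p := ⟨hp0.ne'⟩
  obtain ⟨x, hx⟩ : ∃ x, f x = 0 := by
    obtain ⟨y⟩ := ‹Nonempty X›
    exact ⟨(-((f y).val : ℤ)) +ᵥ y, by rw [hf]; simp⟩
  have hO : ∀ i : ℕ, ∃ O : Set X, IsOpen O ∧ x ∈ O ∧ (0 < i → ∀ y ∈ O, (i : ℤ) +ᵥ y ∉ O) := by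
    intro i
    by_cases hi : 0 < i
    · have hne : (i : ℤ) +ᵥ x ≠ x := fun h => by have := hfree _ _ h; omega
      obtain ⟨A, B, hA, hB, hiA, hxB, hAB⟩ := t2_separation hne
      refine ⟨B ∩ (fun y => (i : ℤ) +ᵥ y) ⁻¹' A, hB.inter (hA.preimage (continuous_const_vadd _)),
        ⟨hxB, hiA⟩, fun _ y hy hy' => Set.disjoint_left.1 hAB hy.2 hy'.1⟩
    · exact ⟨Set.univ, isOpen_univ, Set.mem_univ _, fun h => absurd h hi⟩
  choose O hOo hxO hO using hO
  -- Lying in a fibre of `f` makes return times to `V` multiples of `p`; lying in every `O i` makes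
  -- them exceed `N`.
  obtain ⟨V, hV, hxV, hVO⟩ := compact_exists_isClopen_in_isOpen
    (U := f ⁻¹' {0} ∩ ⋂ i ∈ Set.Iic N, O i)
    (((isOpen_discrete _).preimage hfc).inter
      ((Set.finite_Iic N).isOpen_biInter fun i _ => hOo i))
    (show x ∈ _ from ⟨hx, Set.mem_iInter₂.2 fun i _ => hxO i⟩)
  have hret : ∀ (y : X) (k : ℕ), 0 < k → y ∈ V → (k : ℤ) +ᵥ y ∈ V →
      k ∈ coverLengths R S s := by
    intro y k hk hy hky
    refine hN k ?_ ?_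
    · by_contra! hlt
      exact hO k hk y (Set.mem_iInter₂.1 (hVO hy).2 k hlt.le)
        (Set.mem_iInter₂.1 (hVO hky).2 k hlt.le)
    · have h1 : f ((k : ℤ) +ᵥ y) = 0 := (hVO hky).1
      have h0 : f y = 0 := (hVO hy).1
      rw [hf, h0, zero_add, Int.cast_natCast] at h1
      exact (ZMod.natCast_eq_zero_iff k p).1 h1
  classical
  have hb : ∀ y, ∃ t : ℕ, (-(t : ℤ)) +ᵥ y ∈ V := fun y =>
    (exists_natCast_vadd_mem hV.isOpen ⟨x, hxV⟩ y 0).2.imp fun _ h => h.2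
  have hw : ∀ y, ∃ n : ℕ, 0 < n ∧ (n : ℤ) +ᵥ y ∈ V := fun y =>
    (exists_natCast_vadd_mem hV.isOpen ⟨x, hxV⟩ y 1).1.imp fun _ h => h
  -- `t` is the time since the last visit to `V` (zero on `V`) and `n` the time to the next strictly
  -- later one, so `t y + n y` is the length of the return block containing `y`. The walk is read at
  -- position `t y` of a covering loop chosen by that length alone.
  let t : X → ℕ := fun y => Nat.find (hb y)
  let n : X → ℕ := fun y => Nat.find (hw y)
  have ht : ∀ y k, t y = k ↔ (-(k : ℤ)) +ᵥ y ∈ V ∧ ∀ i < k, (-(i : ℤ)) +ᵥ y ∉ V :=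
    fun y k => Nat.find_eq_iff (hb y)
  have hn : ∀ y k, n y = k ↔ (0 < k ∧ (k : ℤ) +ᵥ y ∈ V) ∧
      ∀ i < k, ¬ (0 < i ∧ (i : ℤ) +ᵥ y ∈ V) := fun y k => Nat.find_eq_iff (hw y)
  have hlen : ∀ y, t y + n y ∈ coverLengths R S s := by
    intro y
    obtain ⟨h1, -⟩ := (ht y _).1 rfl
    obtain ⟨⟨h2, h3⟩, -⟩ := (hn y _).1 rfl
    refine hret _ _ (by omega) h1 ?_
    rw [vadd_vadd]
    convert h3 using 2
    push_cast; ring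
  have hc : ∀ k, ∃ c : ℕ → M, k ∈ coverLengths R S s → c 0 = s ∧ c k = s ∧
      (∀ i < k, R (c i) (c (i + 1))) ∧ c '' Set.Iio k = S := by
    intro k
    by_cases hk : k ∈ coverLengths R S s
    · exact hk.2.imp fun c h _ => h
    · exact ⟨fun _ => s, fun h => absurd h hk⟩
  choose c hc using hc
  refine ⟨fun y => c (t y + n y) (t y), ?_, ?_, ?_⟩
  · refine ((IsLocallyConstant.iff_eventually_eq _).2 fun y => ?_).continuous
    have hev : ∀ i ∈ Set.Icc (-(t y : ℤ)) (n y), ∀ᶠ z in 𝓝 y, (i +ᵥ z ∈ V ↔ i +ᵥ y ∈ V) := by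
      intro i _
      have hVi : IsClopen ((fun z : X => i +ᵥ z) ⁻¹' V) := hV.preimage (continuous_const_vadd _)
      by_cases hi : i +ᵥ y ∈ V
      · filter_upwards [hVi.isOpen.mem_nhds hi] with z hz
        exact ⟨fun _ => hi, fun _ => hz⟩
      · filter_upwards [hVi.compl.isOpen.mem_nhds hi] with z hz
        exact ⟨fun h => absurd h hz, fun h => absurd h hi⟩
    filter_upwards [((Set.finite_Icc _ _).eventually_all).2 hev] with z hz
    have h1 : t z = t y := by
      obtain ⟨h1, h2⟩ := (ht y _).1 rfl
      refine (ht z _).2 ⟨(hz _ ⟨le_refl _, by omega⟩).2 h1, fun i hi h => h2 i hi ?_⟩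
      exact (hz _ ⟨by omega, by omega⟩).1 h
    have h2 : n z = n y := by
      obtain ⟨⟨h1, h2⟩, h3⟩ := (hn y _).1 rfl
      refine (hn z _).2 ⟨⟨h1, (hz _ ⟨by omega, le_refl _⟩).2 h2⟩, fun i hi h => h3 i hi ⟨h.1, ?_⟩⟩
      exact (hz _ ⟨by omega, by omega⟩).1 h.2
    rw [h1, h2]
  · apply Set.Subset.antisymm
    · rintro _ ⟨y, rfl⟩
      obtain ⟨-, -, -, h⟩ := hc _ (hlen y)
      have := ((hn y _).1 rfl).1.1
      exact h.subset ⟨t y, show t y < t y + n y by omega, rfl⟩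
    -- The return block starting at `x ∈ V` runs through one whole covering loop.
    · have htx : t x = 0 := (ht x 0).2 ⟨by simpa using hxV, fun i hi => absurd hi (by omega)⟩
      obtain ⟨⟨h1, h2⟩, h3⟩ := (hn x _).1 rfl
      have hk := hlen x
      rw [htx, zero_add] at hk
      obtain ⟨-, -, -, h⟩ := hc _ hk
      intro m hm
      obtain ⟨i, hi, rfl⟩ := h.superset hm
      have hi' : i < n x := hi
      have hti : t ((i : ℤ) +ᵥ x) = i := by
        refine (ht _ _).2 ⟨by simpa [vadd_vadd] using hxV, fun j hj h => h3 (i - j) (by omega) ?_⟩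
        refine ⟨by omega, ?_⟩
        rw [vadd_vadd] at h
        convert h using 2
        omega
      have hni : n ((i : ℤ) +ᵥ x) = n x - i := by
        refine (hn _ _).2 ⟨⟨by omega, ?_⟩, fun j hj h => h3 (j + i) (by omega) ⟨by omega, ?_⟩⟩
        · rw [vadd_vadd]
          convert h2 using 2
          omega
        · have := h.2
          rw [vadd_vadd] at this
          exact_mod_cast this
      refine ⟨(i : ℤ) +ᵥ x, ?_⟩
      beta_reduce
      rw [hti, hni, Nat.add_sub_cancel' hi'.le]
  · intro y
    beta_reduce
    obtain ⟨c0, ck, hstep, -⟩ := hc _ (hlen y)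
    obtain ⟨h1, h2⟩ := (ht y _).1 rfl
    obtain ⟨⟨h3, h4⟩, h5⟩ := (hn y _).1 rfl
    have hR := hstep (t y) (by omega)
    -- At the end of a block the loop closes at `s`, where the loop of the next block starts,
    -- whatever its length.
    by_cases h : n y = 1
    · have h0 : t ((1 : ℤ) +ᵥ y) = 0 :=
        (ht _ 0).2 ⟨by rw [h] at h4; simpa using h4, fun i hi => absurd hi (by omega)⟩
      obtain ⟨c0', -⟩ := hc _ (hlen ((1 : ℤ) +ᵥ y))
      rw [h] at hR ck
      rw [h0] at c0' ⊢
      rw [c0', h]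
      rwa [ck] at hR
    · have hT : t ((1 : ℤ) +ᵥ y) = t y + 1 := by
        refine (ht _ _).2 ⟨?_, ?_⟩
        · rw [vadd_vadd]
          convert h1 using 2
          push_cast; ring
        · rintro (_ | i) hi hmem
          · exact h5 1 (by omega) ⟨one_pos, by simpa using hmem⟩
          · refine h2 i (by omega) ?_
            rw [vadd_vadd] at hmem
            convert hmem using 2
            push_cast; ring
      have hNx : n ((1 : ℤ) +ᵥ y) = n y - 1 := by
        refine (hn _ _).2 ⟨⟨by omega, ?_⟩, fun i hi hmem => h5 (i + 1) (by omega) ⟨by omega, ?_⟩⟩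
        · rw [vadd_vadd]
          convert h4 using 2
          omega
        · have := hmem.2
          rw [vadd_vadd] at this
          exact_mod_cast this
      rw [hT, hNx, show t y + 1 + (n y - 1) = t y + n y by omega]
      exact hR

end Minimal

/-! ### Qualitative limits -/

theorem isQualitativeLimit_of_periodicSpectrum_eq {X : Type} [TopologicalSpace X] [CompactSpace X]
    [T2Space X] [TotallyDisconnectedSpace X] [Nonempty X] [AddAction ℤ X]
    [ContinuousConstVAdd ℤ X] [AddAction.IsMinimal ℤ X] (hfree : IsFreeAction X) {ρ : ℕ → ℕ}
    (hmono : StrictMono ρ) (hconv : QualitativelyConvergent fun k => cyclicGraph (ρ k))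
    (hspec : periodicSpectrum X = arithmeticSpectrum ρ) :
    IsQualitativeLimit (fun k => cyclicGraph (ρ k)) X := by
  refine ⟨hconv, fun m x h => ?_, fun Q _ _ _ r _ A _ => ?_⟩
  · rw [hfree m x h]
    exact Filter.Eventually.of_forall fun y => zero_vadd _ _
  have hX : ∀ (x : X) (m : ℤ), |m| ≤ 2 * r + 1 → m +ᵥ x = x → m = 0 :=
    fun x m _ h => hfree m x h
  -- Strict monotonicity gives `ρ k ≥ k`, so these cycles have no nonzero period of size at most `2
  -- * r + 1`.
  have hcyc : ∀ k ≥ 2 * r + 2,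
      (∃ φ : (cyclicGraph (ρ k)).Vert → Q, Conf r φ = A) ↔
      A ⊆ Set.range (windowClass (r := r)) ∧ ∃ g : ZMod (ρ k) → Window r Q,
        Set.range g = windowClass ⁻¹' A ∧ ∀ a, Follows (g a) (g (1 + a)) := by
    intro k hk
    let : TopologicalSpace (cyclicGraph (ρ k)).Vert := ⊥
    have : DiscreteTopology (cyclicGraph (ρ k)).Vert := ⟨rfl⟩
    have : ContinuousConstVAdd ℤ (cyclicGraph (ρ k)).Vert := ⟨fun _ => continuous_of_discreteTopology⟩
    have hone : ∀ (g : ZMod (ρ k) → Window r Q) (a : (cyclicGraph (ρ k)).Vert),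
        g ((1 : ℤ) +ᵥ a) = g (1 + (show ZMod (ρ k) from a)) := fun g a =>
      congrArg (fun b : ZMod (ρ k) => g (b + (show ZMod (ρ k) from a))) Int.cast_one
    have hV : ∀ (x : (cyclicGraph (ρ k)).Vert) (m : ℤ), |m| ≤ 2 * r + 1 → m +ᵥ x = x → m = 0 := by
      intro x m hm h
      have h1 : (m : ZMod (ρ k)) = 0 :=
        add_eq_right.1 (show (m : ZMod (ρ k)) + (show ZMod (ρ k) from x) = _ from h)
      rw [ZMod.intCast_zmod_eq_zero_iff_dvd] at h1
      refine Int.eq_zero_of_abs_lt_dvd h1 ?_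
      have := hmono.id_le k
      simp only [id] at this
      omega
    have key := exists_conf_eq_iff (Q := Q) hV A
    constructor
    · rintro ⟨φ, hφ⟩
      obtain ⟨hA, g, -, h1, h2⟩ := key.1 ⟨φ, continuous_of_discreteTopology, hφ⟩
      exact ⟨hA, g, h1, fun a => (congrArg (Follows (g a)) (hone g a)).mp (h2 a)⟩
    · rintro ⟨hA, g, h1, h2⟩
      obtain ⟨φ, -, hφ⟩ := key.2 ⟨hA, g, continuous_of_discreteTopology, h1,
        fun a => (congrArg (Follows (g a)) (hone g a)).mpr (h2 a)⟩
      exact ⟨φ, hφ⟩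
  rw [exists_conf_eq_iff hX A]
  constructor
  · rintro ⟨hA, g, hgc, hgS, hg⟩
    obtain ⟨x⟩ := ‹Nonempty X›
    have hp := setGcd_coverLengths_mem_periodicSpectrum hgc hg hgS
      (s := g x) (hgS ▸ ⟨x, rfl⟩)
    obtain ⟨N, hN⟩ := exists_forall_ge_mem_coverLengths (Follows (r := r) (Q := Q))
      (windowClass ⁻¹' A) (g x)
    rw [hspec] at hp
    obtain ⟨K, hK⟩ := Filter.eventually_atTop.1 hp.2
    refine ⟨N + K + (2 * r + 2), fun k hk => (hcyc k (by omega)).2 ⟨hA, ?_⟩⟩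
    have := hmono.id_le k
    simp only [id] at this
    exact exists_zmod_walk (hN (ρ k) (by omega) (hK k (by omega)))
  · rintro ⟨N, hN⟩
    have hk : ∀ k ≥ N + (2 * r + 2), _ := fun k hk => (hcyc k (by omega)).1 (hN k (by omega))
    obtain ⟨hA, g, hgS, hg⟩ := hk _ le_rfl
    refine ⟨hA, ?_⟩
    have hs : g 0 ∈ windowClass (r := r) (Q := Q) ⁻¹' A := hgS ▸ ⟨0, rfl⟩
    refine exists_equivariant_walk hfree (s := g 0) ?_
    rw [hspec]
    -- Every later walk also has range `S`, hence meets the fixed window `g 0` and can be started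
    -- there.
    have hlen : ∀ k ≥ N + (2 * r + 2), ρ k ∈ coverLengths (Follows (r := r) (Q := Q))
        (windowClass ⁻¹' A) (g 0) := by
      intro k hk'
      obtain ⟨-, g', hgS', hg'⟩ := hk k hk'
      obtain ⟨a, ha⟩ := hgS'.superset hs
      have hpos : 0 < ρ k := by
        have := hmono.id_le k
        simp only [id] at this
        omega
      have : NeZero (ρ k) := ⟨hpos.ne'⟩
      let _ : AddAction ℤ (ZMod (ρ k)) := AddAction.compHom (ZMod (ρ k)) (Int.castAddHom (ZMod (ρ k)))
      have hvadd : ∀ (m : ℤ) (a : ZMod (ρ k)), m +ᵥ a = (m : ZMod (ρ k)) + a := fun _ _ => rfl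
      refine mem_coverLengths_of_orbit (g := g') (x := a) (fun b => ?_) hgS' hpos ha ?_ ?_
      · rw [hvadd]; simpa using hg' b
      · rw [hvadd]; simpa using ha
      · intro t ht
        obtain ⟨b, rfl⟩ := hgS'.superset ht
        exact ⟨(b - a).val, ZMod.val_lt _, by rw [hvadd]; simp⟩
    refine ⟨Nat.pos_of_dvd_of_pos (Nat.setGcd_dvd_of_mem (hlen _ le_rfl)) (hlen _ le_rfl).1, ?_⟩
    exact Filter.eventually_atTop.2 ⟨_, fun k hk => Nat.setGcd_dvd_of_mem (hlen k hk)⟩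

/-! ### Orbit closures of arrays -/

section OrbitClosure

/-- The array `c` shifted by `m` in the second coordinate. -/
def shift (m : ℤ) (c : ℕ × ℤ → Bool) : ℕ × ℤ → Bool := fun p => c (p.1, p.2 + m)

theorem shift_zero (c : ℕ × ℤ → Bool) : shift 0 c = c := by
  funext p
  simp only [shift, add_zero]

theorem shift_add (m n : ℤ) (c : ℕ × ℤ → Bool) : shift (m + n) c = shift m (shift n c) := by
  funext p
  simp only [shift]
  rw [add_assoc]

theorem continuous_shift (m : ℤ) : Continuous (shift m) :=
  continuous_pi fun _ => continuous_apply _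

/-- The closure of the orbit of the array `c` under the shift. -/
def OrbitClosure (c : ℕ × ℤ → Bool) : Type := closure (Set.range fun m => shift m c)

variable (c : ℕ × ℤ → Bool)

instance : TopologicalSpace (OrbitClosure c) :=
  inferInstanceAs (TopologicalSpace (closure (Set.range fun m => shift m c)))

instance : T2Space (OrbitClosure c) :=
  inferInstanceAs (T2Space (closure (Set.range fun m => shift m c)))

instance : TotallyDisconnectedSpace (OrbitClosure c) :=
  inferInstanceAs (TotallyDisconnectedSpace (closure (Set.range fun m => shift m c)))

instance : CompactSpace (OrbitClosure c) :=
  isCompact_iff_compactSpace.1 (isClosed_closure (s := Set.range fun m => shift m c)).isCompact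

theorem shift_mem_closure (m : ℤ) {y : ℕ × ℤ → Bool}
    (hy : y ∈ closure (Set.range fun m => shift m c)) :
    shift m y ∈ closure (Set.range fun m => shift m c) := by
  refine map_mem_closure (continuous_shift m) hy ?_
  rintro _ ⟨n, rfl⟩
  exact ⟨m + n, shift_add m n c⟩

instance : AddAction ℤ (OrbitClosure c) where
  vadd m y := ⟨shift m y.1, shift_mem_closure c m y.2⟩
  zero_vadd y := Subtype.ext (shift_zero y.1)
  add_vadd m n y := Subtype.ext (shift_add m n y.1)

instance : ContinuousConstVAdd ℤ (OrbitClosure c) :=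
  ⟨fun m => ((continuous_shift m).comp continuous_subtype_val).subtype_mk _⟩

/-- The array `c` as a point of its orbit closure. -/
def basePoint : OrbitClosure c := ⟨c, subset_closure ⟨0, shift_zero c⟩⟩

instance : Nonempty (OrbitClosure c) := ⟨basePoint c⟩

variable {c}

theorem vadd_val (m : ℤ) (y : OrbitClosure c) (j : ℕ) (n : ℤ) :
    (m +ᵥ y).1 (j, n) = y.1 (j, n + m) := rfl

theorem isClopen_val (p : ℕ × ℤ) (b : Bool) : IsClopen {y : OrbitClosure c | y.1 p = b} :=
  (isClopen_discrete {b}).preimage ((continuous_apply p).comp continuous_subtype_val)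

theorem denseRange_basePoint : DenseRange fun m : ℤ => m +ᵥ basePoint c := by
  rintro ⟨y, hy⟩
  refine (closure_subtype (X := ℕ × ℤ → Bool)
    (p := fun y => y ∈ closure (Set.range fun m => shift m c))).2 ?_
  refine closure_mono ?_ hy
  rintro _ ⟨m, rfl⟩
  exact ⟨_, ⟨m, rfl⟩, rfl⟩

theorem forall_of_isClosed {P : Set (OrbitClosure c)} (hP : IsClosed P)
    (h : ∀ m : ℤ, m +ᵥ basePoint c ∈ P) (y : OrbitClosure c) : y ∈ P :=
  (denseRange_basePoint.closure_eq ▸ closure_minimal (Set.range_subset_iff.2 h) hP)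
    (Set.mem_univ y)

theorem exists_cylinder_subset {U : Set (OrbitClosure c)} (hU : IsOpen U)
    (hc : basePoint c ∈ U) :
    ∃ J : Finset (ℕ × ℤ), ∀ y : OrbitClosure c, (∀ p ∈ J, y.1 p = c p) → y ∈ U := by
  obtain ⟨O, hO, rfl⟩ := isOpen_induced_iff.1 hU
  obtain ⟨J, u, hu, hJ⟩ := isOpen_pi_iff.1 hO c hc
  exact ⟨J, fun y hy => hJ fun p hp => by rw [hy p hp]; exact (hu p hp).2⟩

/-- Returning to each finite pattern with a finite set of corrections `F` is a closed condition, so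
it passes from the base orbit to every point `y`; hence the orbit of `y` comes near `c`. -/
theorem isMinimal_orbitClosure
    (hrec : ∀ J : Finset (ℕ × ℤ), ∃ F : Finset ℤ, ∀ k : ℤ, ∃ f ∈ F, ∀ p ∈ J,
      c (p.1, p.2 + (f + k)) = c p) :
    AddAction.IsMinimal ℤ (OrbitClosure c) := by
  refine ⟨fun y => dense_iff_inter_open.2 fun U hU hne => ?_⟩
  obtain ⟨m, hm⟩ := denseRange_basePoint.exists_mem_open hU hne
  obtain ⟨J, hJ⟩ := exists_cylinder_subset (hU.preimage (continuous_const_vadd m)) hm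
  obtain ⟨F, hF⟩ := hrec J
  have hclosed : IsClosed (⋃ f ∈ F, ⋂ p ∈ J, (fun z : OrbitClosure c => f +ᵥ z) ⁻¹'
      {z | z.1 p = c p}) :=
    F.finite_toSet.isClosed_biUnion fun f _ => isClosed_biInter fun p _ =>
      (isClopen_val p _).isClosed.preimage (continuous_const_vadd f)
  have := forall_of_isClosed hclosed (fun k => ?_) y
  · obtain ⟨f, -, hf⟩ := Set.mem_iUnion₂.1 this
    refine ⟨m +ᵥ (f +ᵥ y), hJ _ fun p hp => Set.mem_iInter₂.1 hf p hp, m + f, ?_⟩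
    exact add_vadd _ _ _
  · obtain ⟨f, hf, h⟩ := hF k
    refine Set.mem_iUnion₂.2 ⟨f, hf, Set.mem_iInter₂.2 fun p hp => ?_⟩
    change (f +ᵥ (k +ᵥ basePoint c)).1 p = c p
    rw [vadd_vadd]
    exact h p hp

theorem isFreeAction_orbitClosure [AddAction.IsMinimal ℤ (OrbitClosure c)]
    (hc : ∀ m : ℤ, m ≠ 0 → ∃ p : ℕ × ℤ, c (p.1, p.2 + m) ≠ c p) :
    IsFreeAction (OrbitClosure c) := by
  intro m y hy
  by_contra hm
  obtain ⟨p, hp⟩ := hc m hm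
  have hcl : IsClosed {z : OrbitClosure c | m +ᵥ z = z} :=
    isClosed_eq (continuous_const_vadd m) continuous_id
  have hsub : AddAction.orbit ℤ y ⊆ {z : OrbitClosure c | m +ᵥ z = z} := by
    rintro _ ⟨k, rfl⟩
    change m +ᵥ (k +ᵥ y) = k +ᵥ y
    rw [vadd_comm, hy]
  have h := closure_minimal hsub hcl
  rw [(AddAction.IsMinimal.dense_orbit y).closure_eq] at h
  have hbase : m +ᵥ basePoint c = basePoint c := h (Set.mem_univ _)
  exact hp (congrFun (Subtype.ext_iff.1 hbase) p)

end OrbitClosure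

/-! ### Transport to the Cantor set -/

/-- Finitely many translates of an open point would cover `X`, but free orbits are infinite. -/
theorem not_isOpen_singleton_of_isFreeAction {X : Type} [TopologicalSpace X] [CompactSpace X]
    [AddAction ℤ X] [ContinuousConstVAdd ℤ X] [AddAction.IsMinimal ℤ X] (hfree : IsFreeAction X)
    (x : X) : ¬ IsOpen {x} := by
  intro h
  obtain ⟨I, hI⟩ := isCompact_univ.exists_finite_cover_vadd ℤ h ⟨x, rfl⟩
  have hfin : (Set.univ : Set X).Finite :=
    (I.finite_toSet.biUnion fun g _ => (Set.finite_singleton x).image (g +ᵥ ·)).subset hI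
  have : Finite X := Set.finite_univ_iff.1 hfin
  refine not_injective_infinite_finite (fun m : ℤ => m +ᵥ x) fun m n hmn => ?_
  have := hfree (-n + m) x (by rw [add_vadd]; exact (neg_vadd_eq_iff (g := n)).2 hmn)
  omega

theorem exists_action_cantor {X : Type} [TopologicalSpace X] [AddAction ℤ X]
    [ContinuousConstVAdd ℤ X] [AddAction.IsMinimal ℤ X] (hfree : IsFreeAction X)
    (e : X ≃ₜ Cantor) :
    ∃ (_ : AddAction ℤ Cantor) (_ : ContinuousConstVAdd ℤ Cantor),
      IsFreeAction Cantor ∧ AddAction.IsMinimal ℤ Cantor ∧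
      periodicSpectrum Cantor = periodicSpectrum X := by
  let act : AddAction ℤ Cantor :=
    { vadd := fun m b => e (m +ᵥ e.symm b)
      zero_vadd := fun b => by
        change e ((0 : ℤ) +ᵥ e.symm b) = b
        simp
      add_vadd := fun m n b => by
        change e ((m + n) +ᵥ e.symm b) = e (m +ᵥ e.symm (e (n +ᵥ e.symm b)))
        simp [add_vadd] }
  have hdef : ∀ (m : ℤ) (b : Cantor), m +ᵥ b = e (m +ᵥ e.symm b) := fun _ _ => rfl
  have hcont : ContinuousConstVAdd ℤ Cantor :=
    ⟨fun m => e.continuous.comp ((continuous_const_vadd m).comp e.symm.continuous)⟩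
  refine ⟨act, hcont, fun m b h => hfree m (e.symm b) ?_, ⟨fun b => ?_⟩, Set.ext fun n => ?_⟩
  · rw [hdef] at h
    rw [← e.symm_apply_apply (m +ᵥ e.symm b), h]
  · have := e.surjective.denseRange.dense_image e.continuous
      (AddAction.IsMinimal.dense_orbit (M := ℤ) (e.symm b))
    refine this.mono ?_
    rintro _ ⟨_, ⟨m, rfl⟩, rfl⟩
    exact ⟨m, rfl⟩
  · rw [mem_periodicSpectrum_iff, mem_periodicSpectrum_iff]
    refine and_congr_right fun _ => ⟨?_, ?_⟩
    · rintro ⟨f, hf, h⟩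
      refine ⟨f ∘ e, hf.comp e.continuous, fun x => ?_⟩
      have := h (e x)
      rw [hdef, e.symm_apply_apply] at this
      exact this
    · rintro ⟨f, hf, h⟩
      refine ⟨f ∘ e.symm, hf.comp e.symm.continuous, fun b => ?_⟩
      rw [Function.comp_apply, Function.comp_apply, hdef, e.symm_apply_apply]
      exact h _

/-! ### An array with prescribed periodic spectrum -/

section Rotation

theorem exists_fract_mem_Ioo {α : ℝ} (hα : Irrational α) {w : ℤ} (hw : w ≠ 0) (t : ℝ) {u v : ℝ}
    (hu : 0 ≤ u) (huv : u < v) (hv : v ≤ 1) :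
    ∃ m : ℤ, Int.fract (t + m * w * α) ∈ Set.Ioo u v := by
  have hd : Dense (AddSubgroup.closure {w * α, 1} : Set ℝ) :=
    dense_addSubgroupClosure_pair_iff.2 (by simpa using hα.intCast_mul hw)
  obtain ⟨y, hy, hyG⟩ := hd.exists_mem_open (isOpen_Ioo (a := u - t) (b := v - t))
    (Set.nonempty_Ioo.2 (by linarith))
  obtain ⟨m, z, rfl⟩ := AddSubgroup.mem_closure_pair.1 hy
  obtain ⟨h1, h2⟩ := hyG
  simp only [zsmul_eq_mul, mul_one] at h1 h2
  have : Int.fract (t + m * w * α) = t + m * w * α + z := by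
    rw [Int.fract_eq_iff]
    exact ⟨by nlinarith, by nlinarith, -z, by push_cast; ring⟩
  exact ⟨m, by rw [this]; constructor <;> nlinarith⟩

theorem exists_finset_fract_lt {α : ℝ} (hα : Irrational α) {w : ℕ} (hw : 0 < w) {ε : ℝ}
    (hε : 0 < ε) :
    ∃ F : Finset ℤ, ∀ k : ℤ, ∃ f ∈ F, (w : ℤ) ∣ f + k ∧ Int.fract ((f + k : ℤ) * α) < ε := by
  -- The union over integers `z` expresses the condition modulo 1 by open sets, so compactness of
  -- `[0, 1]` leaves finitely many `m`.
  let O : ℤ → Set ℝ := fun m => ⋃ z : ℤ, (fun t : ℝ => t + m * w * α + z) ⁻¹' Set.Ioo 0 (min ε 1)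
  have hO : ∀ m, IsOpen (O m) := fun m =>
    isOpen_iUnion fun z => isOpen_Ioo.preimage (by fun_prop)
  have hcov : Set.Icc (0 : ℝ) 1 ⊆ ⋃ m, O m := by
    intro t _
    obtain ⟨m, hm⟩ := exists_fract_mem_Ioo hα (w := w) (by exact_mod_cast hw.ne') t le_rfl
      (lt_min hε one_pos) (min_le_right ε 1)
    refine Set.mem_iUnion.2 ⟨m, Set.mem_iUnion.2 ⟨-⌊t + m * w * α⌋, ?_⟩⟩
    rw [Int.fract, sub_eq_add_neg] at hm
    push_cast at hm ⊢
    exact hm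
  obtain ⟨I, hI⟩ := isCompact_Icc.elim_finite_subcover O hO hcov
  classical
  -- The remainder `q.2` repairs divisibility by `w`; the multiple `q.1 * w` then adjusts the angle
  -- without spoiling it.
  refine ⟨(I ×ˢ Finset.range w).image fun q => q.1 * w + q.2, fun k => ?_⟩
  obtain ⟨i, hi, hdvd⟩ : ∃ i ∈ Finset.range w, (w : ℤ) ∣ i + k := by
    refine ⟨((-k) % w).toNat, ?_, ?_⟩
    · have := Int.emod_lt_of_pos (-k) (show (0 : ℤ) < w by exact_mod_cast hw)
      rw [Finset.mem_range]
      omega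
    · have h1 := Int.emod_nonneg (-k) (show (w : ℤ) ≠ 0 by exact_mod_cast hw.ne')
      rw [Int.toNat_of_nonneg h1]
      refine ⟨-((-k) / w), ?_⟩
      have := Int.emod_add_mul_ediv (-k) w
      linarith
  have ht : Int.fract ((i + k : ℤ) * α) ∈ Set.Icc (0 : ℝ) 1 :=
    ⟨Int.fract_nonneg _, (Int.fract_lt_one _).le⟩
  obtain ⟨m, hm, hmO⟩ := Set.mem_iUnion₂.1 (hI ht)
  obtain ⟨z, h1, h2⟩ := Set.mem_iUnion.1 hmO
  refine ⟨m * w + i, Finset.mem_image.2 ⟨(m, i), Finset.mem_product.2 ⟨hm, hi⟩, rfl⟩, ?_, ?_⟩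
  · rw [add_assoc]
    exact dvd_add (dvd_mul_left _ _) hdvd
  · have hε1 := lt_of_lt_of_le h2 (min_le_left _ _)
    have h11 := lt_of_lt_of_le h2 (min_le_right _ _)
    have : Int.fract (((m * w + i + k : ℤ) : ℝ) * α) =
        Int.fract ((i + k : ℤ) * α) + m * w * α + z := by
      rw [Int.fract_eq_iff]
      refine ⟨h1.le, h11, ⌊((i + k : ℤ) : ℝ) * α⌋ - z, ?_⟩
      rw [Int.fract]
      push_cast; ring
    rw [this]
    exact hε1

open Classical in
/-- The coding of the rotation by `√2` by a half circle, together with the indicators of the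
multiples of all elements of `W`. -/
noncomputable def spectrumArray (W : Set ℕ) (p : ℕ × ℤ) : Bool :=
  if p.1 = 0 then decide (Int.fract (p.2 * √2) < 1 / 2) else decide (p.1 ∈ W ∧ (p.1 : ℤ) ∣ p.2)

variable {W : Set ℕ}

theorem spectrumArray_zero (n : ℤ) :
    spectrumArray W (0, n) = true ↔ Int.fract (n * √2) < 1 / 2 := by
  simp [spectrumArray]

theorem spectrumArray_of_mem (hpos : ∀ w ∈ W, 0 < w) {w : ℕ} (hw : w ∈ W) (n : ℤ) :
    spectrumArray W (w, n) = true ↔ (w : ℤ) ∣ n := by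
  have := (hpos w hw).ne'
  simp [spectrumArray, hw, this]

theorem exists_forall_spectrumArray_add_eq (h1 : 1 ∈ W)
    (hlcm : ∀ a ∈ W, ∀ b ∈ W, Nat.lcm a b ∈ W) (J : Finset (ℕ × ℤ)) :
    ∃ w ∈ W, ∃ ε > 0, ∀ L : ℤ, (w : ℤ) ∣ L → Int.fract (L * √2) < ε →
      ∀ p ∈ J, spectrumArray W (p.1, p.2 + L) = spectrumArray W p := by
  classical
  induction J using Finset.induction_on with
  | empty => exact ⟨1, h1, 1, one_pos, fun _ _ _ p hp => absurd hp (Finset.notMem_empty p)⟩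
  | insert p J _ ih =>
    obtain ⟨w, hw, ε, hε, h⟩ := ih
    have hp : ∃ w ∈ W, ∃ ε > 0, ∀ L : ℤ, (w : ℤ) ∣ L → Int.fract (L * √2) < ε →
        spectrumArray W (p.1, p.2 + L) = spectrumArray W p := by
      obtain ⟨j, n⟩ := p
      by_cases hj : j = 0
      · subst hj
        have hlt := Int.fract_lt_one (n * √2)
        have hnn := Int.fract_nonneg (n * √2)
        have key : ∀ L : ℤ, Int.fract (n * √2) + Int.fract (L * √2) < 1 →
            Int.fract (((n + L : ℤ) : ℝ) * √2) = Int.fract (n * √2) + Int.fract (L * √2) := by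
          intro L hL
          rw [Int.fract_eq_iff]
          refine ⟨add_nonneg hnn (Int.fract_nonneg _), hL, ⌊(n : ℝ) * √2⌋ + ⌊(L : ℝ) * √2⌋, ?_⟩
          rw [Int.fract, Int.fract]
          push_cast; ring
        -- The arcs `[0, 1/2)` and `[1/2, 1)` are closed on the left, so a one-sided bound suffices:
        -- `ε` is the distance to the right end of the arc.
        by_cases hn : Int.fract (n * √2) < 1 / 2
        · refine ⟨1, h1, 1 / 2 - Int.fract (n * √2), by linarith, fun L _ hL => ?_⟩
          rw [Bool.eq_iff_iff, spectrumArray_zero, spectrumArray_zero, key L (by linarith)]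
          constructor <;> intro <;> linarith
        · refine ⟨1, h1, 1 - Int.fract (n * √2), by linarith, fun L _ hL => ?_⟩
          have := Int.fract_nonneg (L * √2)
          rw [Bool.eq_iff_iff, spectrumArray_zero, spectrumArray_zero, key L (by linarith)]
          constructor <;> intro <;> linarith
      · by_cases hjW : j ∈ W
        · refine ⟨j, hjW, 1, one_pos, fun L hL _ => ?_⟩
          simp [spectrumArray, hj, hjW, dvd_add_left hL]
        · exact ⟨1, h1, 1, one_pos, fun L _ _ => by simp [spectrumArray, hj, hjW]⟩
    obtain ⟨w', hw', ε', hε', h'⟩ := hp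
    refine ⟨Nat.lcm w w', hlcm w hw w' hw', min ε ε', lt_min hε hε', fun L hL hLε q hq => ?_⟩
    rcases Finset.mem_insert.1 hq with rfl | hq
    · exact h' L ((Int.natCast_dvd_natCast.2 (Nat.dvd_lcm_right w w')).trans hL)
        (lt_of_lt_of_le hLε (min_le_right _ _))
    · exact h L ((Int.natCast_dvd_natCast.2 (Nat.dvd_lcm_left w w')).trans hL)
        (lt_of_lt_of_le hLε (min_le_left _ _)) q hq

theorem isMinimal_spectrumArray (hpos : ∀ w ∈ W, 0 < w) (h1 : 1 ∈ W)
    (hlcm : ∀ a ∈ W, ∀ b ∈ W, Nat.lcm a b ∈ W) :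
    AddAction.IsMinimal ℤ (OrbitClosure (spectrumArray W)) := by
  refine isMinimal_orbitClosure fun J => ?_
  obtain ⟨w, hw, ε, hε, h⟩ := exists_forall_spectrumArray_add_eq h1 hlcm J
  obtain ⟨F, hF⟩ := exists_finset_fract_lt irrational_sqrt_two (hpos w hw) hε
  refine ⟨F, fun k => ?_⟩
  obtain ⟨f, hf, hdvd, hlt⟩ := hF k
  exact ⟨f, hf, h _ hdvd hlt⟩

/-- A period `m ≠ 0` would make row zero true at all multiples of `m`, but their angles are dense
and enter `(1/2, 1)`. -/
theorem isFreeAction_spectrumArray [AddAction.IsMinimal ℤ (OrbitClosure (spectrumArray W))] :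
    IsFreeAction (OrbitClosure (spectrumArray W)) := by
  refine isFreeAction_orbitClosure fun m hm => ?_
  by_contra! hper
  have key : ∀ (k : ℤ), spectrumArray W (0, k * m) = true := by
    intro k
    induction k with
    | zero => rw [spectrumArray_zero]; norm_num
    | succ k ih =>
      rw [add_mul, one_mul]
      exact (hper (0, (k : ℤ) * m)).trans ih
    | pred k ih =>
      have := hper (0, (-(k : ℤ) - 1) * m)
      simp only at this
      rw [show (-(k : ℤ) - 1) * m + m = -k * m by ring] at this
      exact this.symm.trans ih
  obtain ⟨k, hk, -⟩ := exists_fract_mem_Ioo irrational_sqrt_two hm 0 (u := 1 / 2) (v := 1)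
    (by norm_num) (by norm_num) le_rfl
  have := (spectrumArray_zero _).1 (key k)
  push_cast at this
  rw [zero_add] at hk
  linarith

theorem periodicSpectrum_spectrumArray (hW : DivisionClosed W) (h1 : 1 ∈ W)
    (hlcm : ∀ a ∈ W, ∀ b ∈ W, Nat.lcm a b ∈ W) :
    periodicSpectrum (OrbitClosure (spectrumArray W)) = W := by
  apply Set.Subset.antisymm
  · intro n hn
    obtain ⟨hn0, f, hf, hf1⟩ := mem_periodicSpectrum_iff.1 hn
    obtain ⟨J, hJ⟩ := exists_cylinder_subset
      (((isOpen_discrete {f (basePoint _)}).preimage hf)) rfl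
    obtain ⟨w, hw, ε, hε, h⟩ := exists_forall_spectrumArray_add_eq h1 hlcm J
    have hw0 := hW.1 w hw
    -- The shift `L = w + m * (w * n)` is a multiple of `w` with small angle, so `f` returns to its
    -- value; as `L ≡ w` mod `n`, it follows that `n ∣ w`.
    obtain ⟨m, -, hm⟩ := exists_fract_mem_Ioo irrational_sqrt_two (w := (w * n : ℕ))
      (by exact_mod_cast (Nat.mul_pos hw0 hn0).ne') (w * √2) le_rfl (lt_min hε one_pos)
      (min_le_right ε 1)
    have hfL : f ((w + m * (w * n) : ℤ) +ᵥ basePoint _) = f (basePoint _) := by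
      refine hJ _ fun p hp => h (w + m * (w * n)) ?_ ?_ p hp
      · exact dvd_add dvd_rfl ((dvd_mul_right _ _).mul_left _)
      · refine lt_of_eq_of_lt ?_ (lt_of_lt_of_le hm (min_le_left _ _))
        push_cast
        ring_nf
    rw [map_vadd_of_map_one_vadd hf1] at hfL
    have h0 : ((w : ℕ) : ZMod n) = 0 := by
      have := add_eq_left.1 hfL
      push_cast at this
      simpa using this
    exact hW.2 w hw n ((ZMod.natCast_eq_zero_iff w n).1 h0)
  · intro w hw
    have hw0 := hW.1 w hw
    have hmem : ∀ (i : ℕ) (y : OrbitClosure (spectrumArray W)),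
        y ∈ (fun y : OrbitClosure (spectrumArray W) => (i : ℤ) +ᵥ y) '' {y | y.1 (w, 0) = true} ↔
          y.1 (w, -i) = true := by
      intro i y
      constructor
      · rintro ⟨z, hz, rfl⟩
        rw [vadd_val, neg_add_cancel]
        exact hz
      · intro h
        refine ⟨(-(i : ℤ)) +ᵥ y, ?_, by simp [vadd_vadd]⟩
        change ((-(i : ℤ)) +ᵥ y).1 (w, 0) = true
        rwa [vadd_val, zero_add]
    have hbase : ∀ (i : ℕ) (m : ℤ), (m +ᵥ basePoint (spectrumArray W)).1 (w, -i) = true ↔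
        (w : ℤ) ∣ m - i := by
      intro i m
      rw [vadd_val, neg_add_eq_sub]
      exact spectrumArray_of_mem hW.1 hw _
    refine ⟨hw0, {y | y.1 (w, 0) = true}, isClopen_val _ _, ?_, ?_⟩
    · refine Set.eq_univ_of_forall fun y => ?_
      -- On the base orbit, covering and disjointness are statements about residues mod `w`; both
      -- are closed conditions and extend to the orbit closure.
      have hcl : IsClosed (⋃ i : Fin w, {y : OrbitClosure (spectrumArray W) |
          y.1 (w, -((i : ℕ) : ℤ)) = true}) :=
        isClosed_iUnion_of_finite fun i => (isClopen_val _ _).isClosed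
      have hy := forall_of_isClosed hcl (fun m => ?_) y
      · obtain ⟨i, hi⟩ := Set.mem_iUnion.1 hy
        exact Set.mem_iUnion.2 ⟨i, (hmem i y).2 hi⟩
      · have h1 := Int.emod_nonneg m (show (w : ℤ) ≠ 0 by exact_mod_cast hw0.ne')
        have h2 := Int.emod_lt_of_pos m (show (0 : ℤ) < w by exact_mod_cast hw0)
        refine Set.mem_iUnion.2 ⟨⟨(m % w).toNat, by omega⟩, (hbase _ m).2 ?_⟩
        simp only [Int.toNat_of_nonneg h1]
        exact Int.dvd_self_sub_emod
    · intro i j hij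
      refine Set.disjoint_left.2 fun y hi hj => ?_
      rw [hmem] at hi hj
      have hcl : IsClosed ({y : OrbitClosure (spectrumArray W) | y.1 (w, -((i : ℕ) : ℤ)) = false} ∪
          {y | y.1 (w, -((j : ℕ) : ℤ)) = false}) :=
        (isClopen_val _ _).isClosed.union (isClopen_val _ _).isClosed
      have hy := forall_of_isClosed hcl (fun m => ?_) y
      · rcases hy with h | h
        · exact Bool.false_ne_true (h.symm.trans hi)
        · exact Bool.false_ne_true (h.symm.trans hj)
      · by_contra hne
        simp only [Set.mem_union, Set.mem_ofPred_eq, not_or, Bool.not_eq_false] at hne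
        rw [hbase, hbase] at hne
        have hd : (w : ℤ) ∣ (j : ℕ) - (i : ℕ) := by
          have := dvd_sub hne.1 hne.2
          rwa [sub_sub_sub_cancel_left] at this
        have h0 := Int.eq_zero_of_abs_lt_dvd hd (by
          have := i.2; have := j.2
          rw [abs_lt]; omega)
        exact hij (Fin.ext (by omega))

end Rotation

/-- Every division-closed set that contains `1` and is closed under least common multiples is the
periodic spectrum of a free minimal action on the Cantor set. -/
theorem exists_free_minimal_action_cantor {W : Set ℕ} (hW : DivisionClosed W) (h1 : 1 ∈ W)
    (hlcm : ∀ a ∈ W, ∀ b ∈ W, Nat.lcm a b ∈ W) :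
    ∃ (_ : AddAction ℤ Cantor) (_ : ContinuousConstVAdd ℤ Cantor),
      IsFreeAction Cantor ∧ AddAction.IsMinimal ℤ Cantor ∧ periodicSpectrum Cantor = W := by
  have := isMinimal_spectrumArray hW.1 h1 hlcm
  have hfree := isFreeAction_spectrumArray (W := W)
  obtain ⟨e⟩ := nonempty_homeomorph_cantor
    (fun n => {y : OrbitClosure (spectrumArray W) | y.1 ((Denumerable.eqv (ℕ × ℤ)).symm n) = true})
    (fun n => isClopen_val _ _)
    (fun x y h => Subtype.ext (funext fun p => by
      have := h (Denumerable.eqv (ℕ × ℤ) p)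
      simp only [Set.mem_ofPred_eq, Equiv.symm_apply_apply] at this
      exact Bool.eq_iff_iff.2 this))
    (not_isOpen_singleton_of_isFreeAction hfree)
  have := exists_action_cantor hfree e
  rwa [periodicSpectrum_spectrumArray hW h1 hlcm] at this

end QualLimit

theorem mainTheorem11 (W : Set ℕ) (hW : QualLimit.DivisionClosed W)
    (ρ : ℕ → ℕ) (hpos : ∀ k, 0 < ρ k) (hmono : StrictMono ρ)
    (hconv : QualLimit.QualitativelyConvergent fun k => QualLimit.cyclicGraph (ρ k))
    (hAr : QualLimit.arithmeticSpectrum ρ = W) :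
    (∃ (_ : AddAction ℤ QualLimit.Cantor) (_ : ContinuousConstVAdd ℤ QualLimit.Cantor),
      QualLimit.IsFreeAction QualLimit.Cantor ∧ AddAction.IsMinimal ℤ QualLimit.Cantor ∧
      QualLimit.periodicSpectrum QualLimit.Cantor = W) ∧
    ∀ (_ : AddAction ℤ QualLimit.Cantor) (_ : ContinuousConstVAdd ℤ QualLimit.Cantor),
      QualLimit.IsFreeAction QualLimit.Cantor → AddAction.IsMinimal ℤ QualLimit.Cantor →
      QualLimit.periodicSpectrum QualLimit.Cantor = W →
      QualLimit.IsQualitativeLimit (fun k => QualLimit.cyclicGraph (ρ k)) QualLimit.Cantor := by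
  constructor
  · refine QualLimit.exists_free_minimal_action_cantor hW ?_ ?_
    · rw [← hAr]
      exact ⟨one_pos, Filter.Eventually.of_forall fun k => one_dvd _⟩
    · rw [← hAr]
      rintro a ⟨ha, ha'⟩ b ⟨hb, hb'⟩
      refine ⟨Nat.lcm_pos ha hb, ?_⟩
      filter_upwards [ha', hb'] with k h1 h2 using Nat.lcm_dvd h1 h2
  · intro _ _ hfree _ hspec
    exact QualLimit.isQualitativeLimit_of_periodicSpectrum_eq hfree hmono hconv
      (hspec.trans hAr.symm)
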